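/- For $0<\alpha<\tfrac12$ let $C_\alpha\subset[0,1]$ be the middle-$(1-2\alpha)$ Cantor set, that is, $C_\alpha=\bigcap_{n\ge 0}\phi_\alpha^{-n}\big([0,\alpha]\cup[1-\alpha,1]\big)$, where $\phi_\alpha$ maps each of $[0,\alpha]$ and $[1-\alpha,1]$ onto $[0,1]$ by an increasing affine map of slope $1/\alpha$. For a compact set $K\subset\mathbb R$ let $\tau(K)$ be its Newhouse thickness, that is, the infimum over all bounded gaps $U$ of $K$ of $\min\{|L_U|,|R_U|\}/|U|$, where the bridges $L_U$ and $R_U$ are the intervals to the left and to the right of $U$ that separate $U$ from the closest gap (bounded or unbounded) of length at least $|U|$. Let $\alpha,\beta\in(0,\tfrac12)$ satisfy $\tau(C_\alpha)\,\tau(C_\beta)<1$, and put $p=1/\alpha$, $q=1/\beta$. (I) Let $\gamma$ be a real number and $n_0,m_0$ coprime natural numbers with $p=\gamma^{n_0}$ and $q=\gamma^{m_0}$. 1. If $\frac1\gamma\le\tau(C_\alpha)\,\tau(C_\beta)$, then for every real number $\lambda$ $$\lambda\in\bigcup_{n=-m_0+1}^{n_0}\gamma^n\cdot\Big[\frac{1-2\alpha}{\gamma\beta},\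 \frac{\alpha}{1-2\beta}\Big]\quad\Longleftrightarrow\quad C_\alpha-\lambda C_\beta=[-\lambda,1].$$ 2. If $\frac1\gamma>\tau(C_\alpha)\,\tau(C_\beta)$, then $C_\alpha-\lambda C_\beta\ne[-\lambda,1]$ for every real number $\lambda$. (II) If $\log\alpha/\log\beta$ is irrational, then $C_\alpha-\lambda C_\beta\ne[-\lambda,1]$ for every real number $\lambda$. Here $C_\alpha-\lambda C_\beta=\{x-\lambda y : x\in C_\alpha,\ y\in C_\beta\}$, and $[-\lambda,1]$ is empty if $-\lambda>1$. -/

import Mathlib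

open Set
open scoped Pointwise ENNReal

noncomputable section

/-- The Markov domain of the middle Cantor set with ratio `α`: the two intervals `[0, α]` and
`[1 - α, 1]`. -/
def markovDomain (α : ℝ) : Set ℝ := Icc 0 α ∪ Icc (1 - α) 1

/-- The expanding map of the middle Cantor set: it maps each of `[0, α]` and `[1 - α, 1]` affinely
onto `[0, 1]` with slope `1 / α`, preserving orientation. (Its values off the Markov domain play no
role.) -/
def expandingMap (α x : ℝ) : ℝ := if x ≤ α then x / α else (x - (1 - α)) / α

/-- The middle Cantor set `C_α` (for `0 < α < 1 / 2`, the middle-`(1 - 2α)` Cantor set): the points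
all of whose iterates under the expanding map stay in the Markov domain. -/
def middleCantorSet (α : ℝ) : Set ℝ :=
  {x | ∀ n : ℕ, (expandingMap α)^[n] x ∈ markovDomain α}

/-- `(a, b)` is a bounded gap of the closed set `K`: a bounded connected component of its
complement. -/
def IsGap (K : Set ℝ) (a b : ℝ) : Prop :=
  a < b ∧ a ∈ K ∧ b ∈ K ∧ Disjoint (Ioo a b) K

/-- The length of the bridge to the right of the gap `(a, b)` of `K`: the interval that starts at
`b` and runs up to the next gap of `K` at least as long as `(a, b)`, or up to the maximum of `K` if
there is no such gap. -/
def rightBridgeLength (K : Set ℝ) (a b : ℝ) : ℝ≥0∞ :=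
  ⨆ c ∈ {c : ℝ | c ∈ K ∧ b ≤ c ∧
    ∀ u v : ℝ, IsGap K u v → b ≤ u → v ≤ c → v - u < b - a}, ENNReal.ofReal (c - b)

/-- The length of the bridge to the left of the gap `(a, b)` of `K`: the interval that ends at
`a` and runs down to the previous gap of `K` at least as long as `(a, b)`, or down to the minimum of
`K` if there is no such gap. -/
def leftBridgeLength (K : Set ℝ) (a b : ℝ) : ℝ≥0∞ :=
  ⨆ c ∈ {c : ℝ | c ∈ K ∧ c ≤ a ∧
    ∀ u v : ℝ, IsGap K u v → c ≤ u → v ≤ a → v - u < b - a}, ENNReal.ofReal (a - c)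

/-- The Newhouse thickness `τ(K)` of a compact set `K` of reals: the infimum, over all bounded gaps
of `K`, of the ratio of the length of the shorter adjacent bridge to the length of the gap. -/
def thickness (K : Set ℝ) : ℝ≥0∞ :=
  ⨅ (a : ℝ) (b : ℝ) (_ : IsGap K a b),
    min (leftBridgeLength K a b) (rightBridgeLength K a b) / ENNReal.ofReal (b - a)

end

/-!
Write `C_α - l • C_β` for the difference set and call `l` the ratio of the two sets.

*Thickness.* Every gap of `C_α` is an affine copy of the central gap `(α, 1 - α)`, whose bridges are
`[0, α]` and `[1 - α, 1]`. Hence the thickness is `α / (1 - 2 * α)` (`thickness_middleCantorSet`), and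
the hypothesis says `α / (1 - 2 * β) < (1 - 2 * α) / β`.

*Necessity.* The distance of `x - l * y` from the end point `-l` is `x + l * (1 - y)`. The first
summand avoids the gap of `C_α` next to `[0, α ^ (k + 1)]`, the second the mirrored gap of `l • C_β` at
depth `j`. If neither of the two gaps is bridged by the other set, there is a hole in the difference
set near `-l`. This forbids `l * β ^ j / α ^ k` from the nonempty open interval
`(α / (1 - 2 * β), (1 - 2 * α) / β)` for all natural `k` and `j` (`ratio_notMem_Ioo_of_sub_eq_Icc`).
If `log α / log β` is irrational, these ratios are dense in the half-line and the difference set is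
never an interval. If `1 / α = γ ^ n₀` and `1 / β = γ ^ m₀`, they are the `l * γ ^ e` for all integers
`e`, so the forbidden interval has to fit between two consecutive powers. This yields the bound on
`1 / γ` and the location of `l` up to a power of `γ` (`exists_zpow_mul_eq_of_sub_eq_Icc`); the central
gaps alone give `1 - 2 * α ≤ l ≤ 1 / (1 - 2 * β)` (`ratio_bounds_of_sub_eq_Icc`), which limits the
power.

*Sufficiency.* Halving `C_α` turns the ratio `l` into `l / α`, and the two intervals of differences
overlap when `1 - 2 * α ≤ l`; halving `C_β` turns `l` into `l * β`, with overlap when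
`l * (1 - 2 * β) ≤ 1`. On the given union of intervals one of the two moves is always allowed and
stays in the union (`sub_eq_Icc_of_zpow_mul`). Hence every point of `[-l, 1]` is approximated by
differences, and it is a difference by compactness (`sub_eq_Icc_of_splitting`).
-/

open Function

variable {α β l : ℝ}

/-! ### The two branches of a middle Cantor set -/

theorem mem_middleCantorSet_iff {x : ℝ} :
    x ∈ middleCantorSet α ↔ x ∈ markovDomain α ∧ expandingMap α x ∈ middleCantorSet α := by
  constructor
  · intro h
    exact ⟨h 0, fun n => by simpa only [← iterate_succ_apply] using h (n + 1)⟩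
  · rintro ⟨h, h'⟩ (_ | n)
    · exact h
    · simpa only [iterate_succ_apply] using h' n

theorem middleCantorSet_subset_Icc (hα : α ∈ Ioo (0 : ℝ) (1 / 2)) :
    middleCantorSet α ⊆ Icc 0 1 := by
  obtain ⟨h0, h1⟩ := hα
  intro x hx
  rcases hx 0 with h | h <;> simp only [iterate_zero, id, mem_Icc] at h
  · exact ⟨h.1, by linarith⟩
  · exact ⟨by linarith, h.2⟩

theorem branch_mem_iff (hα : α ∈ Ioo (0 : ℝ) (1 / 2)) {s x : ℝ} (hs : s = 0 ∨ s = 1 - α)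
    (hx : x ∈ Icc (0 : ℝ) 1) :
    α * x + s ∈ middleCantorSet α ↔ x ∈ middleCantorSet α := by
  obtain ⟨h0, h1⟩ := hα
  obtain ⟨hx0, hx1⟩ := hx
  have hm : 0 ≤ α * x := by positivity
  have hm' : α * x ≤ α := by nlinarith
  rw [mem_middleCantorSet_iff]
  rcases hs with rfl | rfl
  · have hd : α * x + 0 ∈ markovDomain α := Or.inl ⟨by linarith, by linarith⟩
    have hf : expandingMap α (α * x + 0) = x := by
      rw [expandingMap, if_pos (by linarith)]
      field_simp
      ring
    exact ⟨fun h => hf ▸ h.2, fun h => ⟨hd, hf.symm ▸ h⟩⟩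
  · have hd : α * x + (1 - α) ∈ markovDomain α := Or.inr ⟨by linarith, by linarith⟩
    have hf : expandingMap α (α * x + (1 - α)) = x := by
      rw [expandingMap, if_neg (by linarith)]
      field_simp
      ring
    exact ⟨fun h => hf ▸ h.2, fun h => ⟨hd, hf.symm ▸ h⟩⟩

theorem branch_mem (hα : α ∈ Ioo (0 : ℝ) (1 / 2)) {s x : ℝ} (hs : s = 0 ∨ s = 1 - α)
    (hx : x ∈ middleCantorSet α) : α * x + s ∈ middleCantorSet α :=
  (branch_mem_iff hα hs (middleCantorSet_subset_Icc hα hx)).2 hx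

theorem exists_branch (hα : α ∈ Ioo (0 : ℝ) (1 / 2)) {x : ℝ} (hx : x ∈ middleCantorSet α) :
    ∃ s, (s = 0 ∨ s = 1 - α) ∧ ∃ y ∈ middleCantorSet α, x = α * y + s := by
  obtain ⟨h0, h1⟩ := hα
  obtain ⟨hd, hm⟩ := mem_middleCantorSet_iff.1 hx
  rcases hd with h | h
  · refine ⟨0, Or.inl rfl, _, hm, ?_⟩
    rw [expandingMap, if_pos h.2]
    field_simp
    ring
  · refine ⟨1 - α, Or.inr rfl, _, hm, ?_⟩
    rw [expandingMap, if_neg (by linarith [h.1])]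
    field_simp
    ring

theorem zero_mem_middleCantorSet (hα : α ∈ Ioo (0 : ℝ) (1 / 2)) : 0 ∈ middleCantorSet α := by
  have hf : IsFixedPt (expandingMap α) 0 := by simp [IsFixedPt, expandingMap, hα.1.le]
  intro n
  rw [hf.iterate n]
  exact Or.inl ⟨le_rfl, hα.1.le⟩

theorem one_mem_middleCantorSet (hα : α ∈ Ioo (0 : ℝ) (1 / 2)) : 1 ∈ middleCantorSet α := by
  obtain ⟨h0, h1⟩ := hα
  have hf : IsFixedPt (expandingMap α) 1 := by
    rw [IsFixedPt, expandingMap, if_neg (by linarith)]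
    field_simp
    ring
  intro n
  rw [hf.iterate n]
  exact Or.inr ⟨by linarith, le_rfl⟩

theorem isCompact_middleCantorSet (hα : α ∈ Ioo (0 : ℝ) (1 / 2)) :
    IsCompact (middleCantorSet α) := by
  refine isCompact_Icc.of_isClosed_subset ?_ (middleCantorSet_subset_Icc hα)
  obtain ⟨h0, h1⟩ := hα
  have key : ∀ n : ℕ, IsClosed {x | ∀ i ≤ n, (expandingMap α)^[i] x ∈ markovDomain α} := by
    intro n
    induction n with
    | zero =>
      have e : {x | ∀ i ≤ 0, (expandingMap α)^[i] x ∈ markovDomain α} =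
          Icc 0 α ∪ Icc (1 - α) 1 := by
        ext x
        simp [markovDomain]
      exact e ▸ isClosed_Icc.union isClosed_Icc
    | succ n ih =>
      -- `expandingMap α` jumps at `α`, but it is affine on each half of the Markov domain
      have e : {x | ∀ i ≤ n + 1, (expandingMap α)^[i] x ∈ markovDomain α} =
          (Icc 0 α ∩ (fun x => x / α) ⁻¹'
            {x | ∀ i ≤ n, (expandingMap α)^[i] x ∈ markovDomain α}) ∪
          (Icc (1 - α) 1 ∩ (fun x => (x - (1 - α)) / α) ⁻¹'
            {x | ∀ i ≤ n, (expandingMap α)^[i] x ∈ markovDomain α}) := by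
        ext x
        have h : (∀ i ≤ n + 1, (expandingMap α)^[i] x ∈ markovDomain α) ↔
            x ∈ markovDomain α ∧
              ∀ i ≤ n, (expandingMap α)^[i] (expandingMap α x) ∈ markovDomain α := by
          constructor
          · exact fun h => ⟨h 0 (by omega), fun i hi => h (i + 1) (by omega)⟩
          · rintro ⟨h, h'⟩ (_ | i) hi
            · exact h
            · exact h' i (by omega)
        simp only [mem_ofPred_eq, h, mem_union, mem_inter_iff, mem_preimage]
        rw [markovDomain, mem_union, or_and_right]
        refine or_congr (and_congr_right fun hx => ?_) (and_congr_right fun hx => ?_)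
        · rw [expandingMap, if_pos hx.2]
        · rw [expandingMap, if_neg (by linarith [hx.1])]
      rw [e]
      exact (isClosed_Icc.inter (ih.preimage (by fun_prop))).union
        (isClosed_Icc.inter (ih.preimage (by fun_prop)))
  have e : middleCantorSet α =
      ⋂ n : ℕ, {x | ∀ i ≤ n, (expandingMap α)^[i] x ∈ markovDomain α} := by
    ext x
    simp only [middleCantorSet, mem_ofPred_eq, mem_iInter]
    exact ⟨fun h n i _ => h i, fun h n => h n n le_rfl⟩
  rw [e]
  exact isClosed_iInter key

/-- The `k`-th gap of a middle Cantor set next to its minimum is `(α ^ (k + 1), α ^ k * (1 - α))`. -/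
theorem le_pow_or_le_of_mem (hα : α ∈ Ioo (0 : ℝ) (1 / 2)) (k : ℕ) {x : ℝ}
    (hx : x ∈ middleCantorSet α) : x ≤ α ^ (k + 1) ∨ α ^ k * (1 - α) ≤ x := by
  have h0 := hα.1
  have h1 := hα.2
  induction k generalizing x with
  | zero => rcases hx 0 with h | h <;> simp only [iterate_zero, id, mem_Icc] at h <;> simp [h]
  | succ k ih =>
    obtain ⟨s, rfl | rfl, y, hy, rfl⟩ := exists_branch hα hx
    · refine (ih hy).imp (fun h => ?_) (fun h => ?_)
      · calc α * y + 0 ≤ α * α ^ (k + 1) + 0 := by gcongr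
          _ = _ := by ring
      · calc α ^ (k + 1) * (1 - α) = α * (α ^ k * (1 - α)) + 0 := by ring
          _ ≤ _ := by gcongr
    · right
      have hp : α ^ (k + 1) ≤ 1 := pow_le_one₀ h0.le (by linarith)
      have hy0 := (middleCantorSet_subset_Icc hα hy).1
      nlinarith [mul_nonneg h0.le hy0]

/-- The mirror image of `le_pow_or_le_of_mem`: the gaps next to the maximum. -/
theorem one_sub_le_pow_or_le_of_mem (hα : α ∈ Ioo (0 : ℝ) (1 / 2)) (k : ℕ) {x : ℝ}
    (hx : x ∈ middleCantorSet α) : 1 - x ≤ α ^ (k + 1) ∨ α ^ k * (1 - α) ≤ 1 - x := by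
  have h0 := hα.1
  have h1 := hα.2
  induction k generalizing x with
  | zero =>
    rcases hx 0 with h | h <;> simp only [iterate_zero, id, mem_Icc] at h
    · exact Or.inr (by linarith [h.2])
    · exact Or.inl (by rw [zero_add, pow_one]; linarith [h.1])
  | succ k ih =>
    obtain ⟨s, rfl | rfl, y, hy, rfl⟩ := exists_branch hα hx
    · right
      have hp : α ^ (k + 1) ≤ 1 := pow_le_one₀ h0.le (by linarith)
      have hy1 := (middleCantorSet_subset_Icc hα hy).2
      nlinarith [mul_le_mul_of_nonneg_left hy1 h0.le]
    · refine (ih hy).imp (fun h => ?_) (fun h => ?_)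
      · calc 1 - (α * y + (1 - α)) = α * (1 - y) := by ring
          _ ≤ α * α ^ (k + 1) := by gcongr
          _ = _ := by ring
      · calc α ^ (k + 1) * (1 - α) = α * (α ^ k * (1 - α)) := by ring
          _ ≤ α * (1 - y) := by gcongr
          _ = _ := by ring

/-! ### Gaps and thickness -/

theorem isGap_of_branch (hα : α ∈ Ioo (0 : ℝ) (1 / 2)) {s x y : ℝ} (hs : s = 0 ∨ s = 1 - α)
    (hx : x ∈ Icc (0 : ℝ) 1) (hy : y ∈ Icc (0 : ℝ) 1)
    (h : IsGap (middleCantorSet α) (α * x + s) (α * y + s)) :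
    IsGap (middleCantorSet α) x y := by
  obtain ⟨hlt, hxC, hyC, hd⟩ := h
  have h0 := hα.1
  refine ⟨by nlinarith, (branch_mem_iff hα hs hx).1 hxC, (branch_mem_iff hα hs hy).1 hyC, ?_⟩
  rw [Set.disjoint_left] at hd ⊢
  rintro z ⟨hxz, hzy⟩ hz
  exact hd ⟨by nlinarith, by nlinarith⟩ (branch_mem hα hs hz)

/-- A gap between two points of the same branch, `[0, α]` or `[1 - α, 1]`, is a copy of a gap. -/
theorem exists_isGap_of_mem_Icc (hα : α ∈ Ioo (0 : ℝ) (1 / 2)) {s u v : ℝ}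
    (hs : s = 0 ∨ s = 1 - α) (hu : s ≤ u) (hv : v ≤ α + s) (h : IsGap (middleCantorSet α) u v) :
    ∃ x y, IsGap (middleCantorSet α) x y ∧ u = α * x + s ∧ v = α * y + s := by
  have h0 := hα.1
  have e : ∀ w : ℝ, α * ((w - s) / α) + s = w := fun w => by field_simp; ring
  have huv := h.1
  refine ⟨(u - s) / α, (v - s) / α, isGap_of_branch hα hs ?_ ?_ ?_, (e u).symm, (e v).symm⟩
  · exact ⟨div_nonneg (by linarith) h0.le, (div_le_one h0).2 (by linarith)⟩
  · exact ⟨div_nonneg (by linarith) h0.le, (div_le_one h0).2 (by linarith)⟩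
  · rwa [e, e]

theorem isGap_central (hα : α ∈ Ioo (0 : ℝ) (1 / 2)) :
    IsGap (middleCantorSet α) α (1 - α) := by
  have h0 := hα.1
  have h1 := hα.2
  refine ⟨by linarith, ?_, ?_, ?_⟩
  · simpa using branch_mem hα (Or.inl rfl) (one_mem_middleCantorSet hα)
  · simpa using branch_mem hα (Or.inr rfl) (zero_mem_middleCantorSet hα)
  · rw [Set.disjoint_left]
    rintro z ⟨h, h'⟩ hz
    rcases hz 0 with hz | hz <;> simp only [iterate_zero, id, mem_Icc] at hz <;> linarith [hz.1, hz.2]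

theorem isGap_cases (hα : α ∈ Ioo (0 : ℝ) (1 / 2)) {u v : ℝ}
    (h : IsGap (middleCantorSet α) u v) :
    (u = α ∧ v = 1 - α) ∨ ∃ s, (s = 0 ∨ s = 1 - α) ∧
      ∃ x y, IsGap (middleCantorSet α) x y ∧ u = α * x + s ∧ v = α * y + s := by
  have h0 := hα.1
  have h1 := hα.2
  have hc := isGap_central hα
  obtain ⟨huv, hu, hv, hd⟩ := h
  rw [Set.disjoint_left] at hd
  rcases hu 0 with hu0 | hu0 <;> rcases hv 0 with hv0 | hv0 <;>
    simp only [iterate_zero, id, mem_Icc] at hu0 hv0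
  · exact Or.inr ⟨0, Or.inl rfl, exists_isGap_of_mem_Icc hα (Or.inl rfl) hu0.1 (by linarith [hv0.2])
      ⟨huv, hu, hv, Set.disjoint_left.2 hd⟩⟩
  · left
    constructor
    · by_contra hne
      exact hd ⟨lt_of_le_of_ne hu0.2 hne, by linarith [hv0.1]⟩ hc.2.1
    · by_contra hne
      exact hd ⟨by linarith [hu0.2], lt_of_le_of_ne hv0.1 (Ne.symm hne)⟩ hc.2.2.1
  · linarith [hu0.1, hv0.2]
  · exact Or.inr ⟨1 - α, Or.inr rfl, exists_isGap_of_mem_Icc hα (Or.inr rfl) hu0.1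
      (by linarith [hv0.2]) ⟨huv, hu, hv, Set.disjoint_left.2 hd⟩⟩

/-- Induction over the gaps of a middle Cantor set: every gap is obtained from the central one by
finitely many branches, since undoing a branch lengthens a gap by the factor `1 / α`. -/
@[elab_as_elim]
theorem isGap_induction (hα : α ∈ Ioo (0 : ℝ) (1 / 2)) {P : ℝ → ℝ → Prop}
    (central : P α (1 - α))
    (branch : ∀ s x y, (s = 0 ∨ s = 1 - α) → IsGap (middleCantorSet α) x y → P x y →
      P (α * x + s) (α * y + s)) {u v : ℝ} (h : IsGap (middleCantorSet α) u v) : P u v := by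
  have h0 := hα.1
  have h1 := hα.2
  have key : ∀ (n : ℕ) (u v : ℝ), IsGap (middleCantorSet α) u v → α ^ n < v - u → P u v := by
    intro n
    induction n with
    | zero =>
      intro u v h hlt
      have hu := middleCantorSet_subset_Icc hα h.2.1
      have hv := middleCantorSet_subset_Icc hα h.2.2.1
      rw [pow_zero] at hlt
      linarith [hu.1, hv.2]
    | succ n ih =>
      intro u v h hlt
      rcases isGap_cases hα h with ⟨rfl, rfl⟩ | ⟨s, hs, x, y, hg, rfl, rfl⟩
      · exact central
      · refine branch s x y hs hg (ih x y hg ?_)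
        rw [pow_succ] at hlt
        nlinarith
  obtain ⟨n, hn⟩ := exists_pow_lt_of_lt_one (sub_pos.2 h.1) (by linarith : α < 1)
  exact key n u v h hn

theorem isGap_length_le (hα : α ∈ Ioo (0 : ℝ) (1 / 2)) {u v : ℝ}
    (h : IsGap (middleCantorSet α) u v) : v - u ≤ 1 - 2 * α := by
  have h0 := hα.1
  have h1 := hα.2
  refine isGap_induction hα ?_ ?_ h
  · linarith
  · intro s x y hs hg ih
    nlinarith [hg.1]

/-- Both bridges of a gap are at least `α / (1 - 2 * α)` times as long as the gap: its neighbours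
are the images of `[0, α]` and `[1 - α, 1]` under the branches that carry the central gap to it. -/
theorem exists_bridges (hα : α ∈ Ioo (0 : ℝ) (1 / 2)) {a b : ℝ}
    (h : IsGap (middleCantorSet α) a b) :
    (∃ c ∈ middleCantorSet α, c ≤ a ∧ a - c = α / (1 - 2 * α) * (b - a) ∧
      ∀ u v, IsGap (middleCantorSet α) u v → c ≤ u → v ≤ a → v - u < b - a) ∧
    (∃ d ∈ middleCantorSet α, b ≤ d ∧ d - b = α / (1 - 2 * α) * (b - a) ∧
      ∀ u v, IsGap (middleCantorSet α) u v → b ≤ u → v ≤ d → v - u < b - a) := by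
  have h0 := hα.1
  have h1 := hα.2
  have h2 : 0 < 1 - 2 * α := by linarith
  refine isGap_induction hα ?_ ?_ h
  · -- a gap inside one of the two halves is a copy of another gap, hence shorter than the central one
    have short : ∀ s, (s = 0 ∨ s = 1 - α) → ∀ u v, IsGap (middleCantorSet α) u v → s ≤ u →
        v ≤ α + s → v - u < 1 - α - α := by
      intro s hs u v hg hu hv
      obtain ⟨x, y, hg', rfl, rfl⟩ := exists_isGap_of_mem_Icc hα hs hu hv hg
      nlinarith [isGap_length_le hα hg']
    have e : α / (1 - 2 * α) * (1 - α - α) = α := by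
      rw [show 1 - α - α = 1 - 2 * α by ring, div_mul_cancel₀ _ h2.ne']
    refine ⟨⟨0, zero_mem_middleCantorSet hα, h0.le, by linarith, fun u v hg hu hv => ?_⟩,
      ⟨1, one_mem_middleCantorSet hα, by linarith, by linarith, fun u v hg hu hv => ?_⟩⟩
    · exact short 0 (Or.inl rfl) u v hg hu (by linarith)
    · exact short (1 - α) (Or.inr rfl) u v hg hu (by linarith)
  · intro s x y hs hg ih
    have hx := middleCantorSet_subset_Icc hα hg.2.1
    have hy := middleCantorSet_subset_Icc hα hg.2.2.1
    have hs' : 0 ≤ s ∧ s ≤ 1 - α := by rcases hs with rfl | rfl <;> constructor <;> linarith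
    obtain ⟨⟨c, hc, hcx, hce, hcg⟩, ⟨d, hd, hyd, hde, hdg⟩⟩ := ih
    have hc' := middleCantorSet_subset_Icc hα hc
    have hd' := middleCantorSet_subset_Icc hα hd
    refine ⟨⟨α * c + s, branch_mem hα hs hc, by nlinarith, ?_, fun u v hg hu hv => ?_⟩,
      ⟨α * d + s, branch_mem hα hs hd, by nlinarith, ?_, fun u v hg hu hv => ?_⟩⟩
    · linear_combination α * hce
    · obtain ⟨u, v, hg', rfl, rfl⟩ := exists_isGap_of_mem_Icc hα hs
        (by nlinarith [hc'.1]) (by nlinarith [hx.2]) hg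
      nlinarith [hcg u v hg' (by nlinarith) (by nlinarith)]
    · linear_combination α * hde
    · obtain ⟨u, v, hg', rfl, rfl⟩ := exists_isGap_of_mem_Icc hα hs
        (by nlinarith [hy.1]) (by nlinarith [hd'.2]) hg
      nlinarith [hdg u v hg' (by nlinarith) (by nlinarith)]

theorem thickness_middleCantorSet (hα : α ∈ Ioo (0 : ℝ) (1 / 2)) :
    thickness (middleCantorSet α) = ENNReal.ofReal (α / (1 - 2 * α)) := by
  have h0 := hα.1
  have h1 := hα.2
  have h2 : 0 < 1 - 2 * α := by linarith
  apply le_antisymm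
  · refine (iInf_le_of_le α (iInf_le_of_le (1 - α) (iInf_le _ (isGap_central hα)))).trans ?_
    rw [ENNReal.ofReal_div_of_pos h2, show 1 - α - α = 1 - 2 * α by ring]
    gcongr
    refine (min_le_right _ _).trans (iSup₂_le fun c hc => ?_)
    exact ENNReal.ofReal_le_ofReal (by linarith [(middleCantorSet_subset_Icc hα hc.1).2])
  · refine le_iInf fun a => le_iInf fun b => le_iInf fun h => ?_
    have hab : 0 < b - a := sub_pos.2 h.1
    obtain ⟨⟨c, hc, hca, hce, hcg⟩, ⟨d, hd, hbd, hde, hdg⟩⟩ := exists_bridges hα h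
    rw [ENNReal.le_div_iff_mul_le (Or.inl (by simpa using hab)) (Or.inl ENNReal.ofReal_ne_top),
      ← ENNReal.ofReal_mul (by positivity)]
    refine le_min ?_ ?_
    · rw [← hce]
      exact le_iSup₂_of_le c ⟨hc, hca, hcg⟩ le_rfl
    · rw [← hde]
      exact le_iSup₂_of_le d ⟨hd, hbd, hdg⟩ le_rfl

/-! ### Necessary conditions: gaps of the difference set near its minimum -/

/-- Near the corner `-l` the point `x - l * y` lies at distance `x + l * (1 - y)` from `-l`. If the
first summand avoids `(a, A)` and the second avoids `(b, B)`, then the distance avoids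
`(a + b, min A B)`. When the difference set is the whole interval, this interval must be empty or lie
beyond the largest possible distance `1 + l`. -/
theorem le_add_of_sub_eq_Icc (h : middleCantorSet α - l • middleCantorSet β = Icc (-l) 1)
    (hα : α ∈ Ioo (0 : ℝ) (1 / 2)) (hβ : β ∈ Ioo (0 : ℝ) (1 / 2)) (hl : 0 < l) {a A b B : ℝ}
    (ha : 0 ≤ a) (hb : 0 ≤ b) (hA : ∀ x ∈ middleCantorSet α, x ≤ a ∨ A ≤ x)
    (hB : ∀ y ∈ middleCantorSet β, l * (1 - y) ≤ b ∨ B ≤ l * (1 - y)) :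
    A ≤ a + b ∨ B ≤ a + b ∨ 1 + l ≤ a + b := by
  by_contra! hcon
  obtain ⟨h1, h2, h3⟩ := hcon
  obtain ⟨s, hs, hs'⟩ := exists_between (lt_min h1 (lt_min h2 h3))
  simp only [lt_min_iff] at hs'
  have hmem : -l + s ∈ middleCantorSet α - l • middleCantorSet β := by
    rw [h]
    exact ⟨by linarith, by linarith⟩
  obtain ⟨x, hx, -, ⟨y, hy, rfl⟩, hxy⟩ := Set.mem_sub.1 hmem
  simp only [smul_eq_mul] at hxy
  have hx0 := (middleCantorSet_subset_Icc hα hx).1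
  have hy0 : 0 ≤ l * (1 - y) :=
    mul_nonneg hl.le (sub_nonneg.2 (middleCantorSet_subset_Icc hβ hy).2)
  rcases hA x hx with hx' | hx' <;> rcases hB y hy with hy' | hy' <;> linarith

theorem pos_of_sub_eq_Icc (h : middleCantorSet α - l • middleCantorSet β = Icc (-l) 1)
    (hα : α ∈ Ioo (0 : ℝ) (1 / 2)) (hβ : β ∈ Ioo (0 : ℝ) (1 / 2)) : 0 < l := by
  have h0 := zero_mem_middleCantorSet hα
  by_contra! hl
  rcases hl.lt_or_eq with hl | rfl
  · have : (0 : ℝ) ∈ Icc (-l) 1 := by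
      rw [← h]
      exact Set.mem_sub.2 ⟨0, h0, l • 0,
        Set.smul_mem_smul_set (zero_mem_middleCantorSet hβ), by simp⟩
    linarith [this.1]
  · have : (1 / 2 : ℝ) ∈ middleCantorSet α - (0 : ℝ) • middleCantorSet β := by
      rw [h]
      constructor <;> norm_num
    obtain ⟨x, hx, -, ⟨y, hy, rfl⟩, hxy⟩ := Set.mem_sub.1 this
    simp only [zero_smul, sub_zero] at hxy
    have := le_pow_or_le_of_mem hα 0 hx
    simp only [zero_add, pow_one, pow_zero, one_mul] at this
    rcases this with h | h <;> linarith [hα.2]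

theorem ratio_bounds_of_sub_eq_Icc (h : middleCantorSet α - l • middleCantorSet β = Icc (-l) 1)
    (hα : α ∈ Ioo (0 : ℝ) (1 / 2)) (hβ : β ∈ Ioo (0 : ℝ) (1 / 2)) :
    1 - 2 * α ≤ l ∧ l * (1 - 2 * β) ≤ 1 := by
  have hl := pos_of_sub_eq_Icc h hα hβ
  have h0 := hα.1
  have h1 := hα.2
  have h0' := hβ.1
  have h1' := hβ.2
  constructor
  · have := le_add_of_sub_eq_Icc h hα hβ hl (a := α) (A := 1 - α) (b := l) (B := 1 + l) h0.le hl.le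
      (fun x hx => by simpa using le_pow_or_le_of_mem hα 0 hx)
      (fun y hy => Or.inl (by nlinarith [(middleCantorSet_subset_Icc hβ hy).1]))
    rcases this with h | h | h <;> linarith
  · have := le_add_of_sub_eq_Icc h hα hβ hl (a := 1) (A := 1 + l) (b := l * β) (B := l * (1 - β))
      zero_le_one (by positivity) (fun x hx => Or.inl (middleCantorSet_subset_Icc hα hx).2)
      (fun y hy => by
        have := one_sub_le_pow_or_le_of_mem hβ 0 hy
        rw [zero_add, pow_one, pow_zero, one_mul] at this
        exact this.imp (fun h => by gcongr) (fun h => by gcongr))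
    rcases this with h | h | h <;> nlinarith

/-- The copy of scale `α ^ (k + 1)` of the first set and the one of scale `β ^ (j + 1)` of the second
meet the corner `-l`; the gaps beyond both of them leave a hole unless the ratio `l * β ^ j / α ^ k`
avoids the interval `(α / (1 - 2 * β), (1 - 2 * α) / β)`. -/
theorem ratio_notMem_Ioo_of_sub_eq_Icc
    (h : middleCantorSet α - l • middleCantorSet β = Icc (-l) 1)
    (hα : α ∈ Ioo (0 : ℝ) (1 / 2)) (hβ : β ∈ Ioo (0 : ℝ) (1 / 2)) (k j : ℕ) :
    l * β ^ j / α ^ k ∉ Ioo (α / (1 - 2 * β)) ((1 - 2 * α) / β) := by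
  have hl := pos_of_sub_eq_Icc h hα hβ
  have h0 := hα.1
  have h1 := hα.2
  have h0' := hβ.1
  have h1' := hβ.2
  have hk : 0 < α ^ k := by positivity
  have hj : 0 < β ^ j := by positivity
  have h2 : 0 < 1 - 2 * β := by linarith
  rintro ⟨hlo, hhi⟩
  rw [div_lt_div_iff₀ h2 hk] at hlo
  rw [div_lt_div_iff₀ hk h0'] at hhi
  have := le_add_of_sub_eq_Icc h hα hβ hl (a := α ^ (k + 1)) (A := α ^ k * (1 - α))
    (b := l * β ^ (j + 1)) (B := l * (β ^ j * (1 - β))) (by positivity) (by positivity)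
    (fun x hx => le_pow_or_le_of_mem hα k hx)
    (fun y hy => (one_sub_le_pow_or_le_of_mem hβ j hy).imp
      (fun h => by gcongr) (fun h => by gcongr))
  rw [pow_succ, pow_succ] at this
  have hk1 : α ^ k ≤ 1 := pow_le_one₀ h0.le (by linarith)
  have hj1 : β ^ j ≤ 1 := pow_le_one₀ h0'.le (by linarith)
  rcases this with h | h | h
  · nlinarith
  · nlinarith
  · have e1 : α ^ k * α < 1 := by nlinarith
    have e2 : β ^ j * β ≤ 1 := by nlinarith
    nlinarith [mul_le_mul_of_nonneg_left e2 hl.le]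

/-! ### A sufficient condition: families of ratios closed under splitting -/

/-- Splitting a copy of `C_α` into its two halves multiplies the ratio by `1 / α`, splitting a copy of
`C_β` multiplies it by `β`. If each ratio of a bounded family allows a splitting for which the two
halves of the interval of differences still overlap, and the new ratio is in the family again, then
the difference sets are whole intervals. -/
theorem sub_eq_Icc_of_splitting (hα : α ∈ Ioo (0 : ℝ) (1 / 2)) (hβ : β ∈ Ioo (0 : ℝ) (1 / 2))
    {S : Set ℝ} {m M : ℝ} (hm : 0 < m) (hS : S ⊆ Icc m M)
    (hsplit : ∀ r ∈ S, (1 - 2 * α ≤ r ∧ r / α ∈ S) ∨ (r * (1 - 2 * β) ≤ 1 ∧ r * β ∈ S))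
    (hl : l ∈ S) : middleCantorSet α - l • middleCantorSet β = Icc (-l) 1 := by
  have h0 := hα.1
  have h1 := hα.2
  have h0' := hβ.1
  have h1' := hβ.2
  have hmM : m ≤ M := (hS hl).1.trans (hS hl).2
  -- one splitting shrinks the total length `1 + r` at least by this factor
  obtain ⟨ρ, hρ0, hρ1, hρα, hρβ⟩ : ∃ ρ : ℝ, 0 < ρ ∧ ρ < 1 ∧ (∀ r ∈ S, α + r ≤ ρ * (1 + r)) ∧
      ∀ r ∈ S, 1 + r * β ≤ ρ * (1 + r) := by
    have hM : 0 < 1 + M := by linarith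
    have hm' : 0 < 1 + m := by linarith
    refine ⟨max ((α + M) / (1 + M)) ((1 + m * β) / (1 + m)), lt_max_of_lt_left (by
      apply div_pos <;> linarith), max_lt ?_ ?_, fun r hr => ?_, fun r hr => ?_⟩
    · rw [div_lt_one hM]; linarith
    · rw [div_lt_one hm']; nlinarith
    · have hr' := hS hr
      have : (α + r) / (1 + r) ≤ (α + M) / (1 + M) := by
        rw [div_le_div_iff₀ (by linarith [hr'.1]) hM]
        nlinarith [hr'.2]
      rw [← div_le_iff₀ (by linarith [hr'.1])]
      exact this.trans (le_max_left _ _)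
    · have hr' := hS hr
      have : (1 + r * β) / (1 + r) ≤ (1 + m * β) / (1 + m) := by
        rw [div_le_div_iff₀ (by linarith [hr'.1]) hm']
        nlinarith [hr'.1]
      rw [← div_le_iff₀ (by linarith [hr'.1])]
      exact this.trans (le_max_right _ _)
  have approx : ∀ (n : ℕ), ∀ r ∈ S, ∀ t ∈ Icc (-r) 1, ∃ x ∈ middleCantorSet α,
      ∃ y ∈ middleCantorSet β, |x - r * y - t| ≤ ρ ^ n * (1 + r) := by
    intro n
    induction n with
    | zero =>
      intro r hr t ht
      have hr' := hS hr
      refine ⟨0, zero_mem_middleCantorSet hα, 0, zero_mem_middleCantorSet hβ, ?_⟩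
      rw [abs_le]
      constructor <;> linarith [ht.1, ht.2, hr'.1]
    | succ n ih =>
      intro r hr t ht
      have hρn : 0 < ρ ^ n := by positivity
      have hr0 : 0 < r := hm.trans_le (hS hr).1
      rcases hsplit r hr with ⟨hle, hmem⟩ | ⟨hle, hmem⟩
      · obtain ⟨s, hs, hts⟩ : ∃ s, (s = 0 ∨ s = 1 - α) ∧ t - s ∈ Icc (-r) α := by
          by_cases hta : t ≤ α
          · exact ⟨0, Or.inl rfl, by linarith [ht.1], by linarith⟩
          · exact ⟨1 - α, Or.inr rfl, by linarith, by linarith [ht.2]⟩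
        obtain ⟨x, hx, y, hy, hxy⟩ := ih (r / α) hmem ((t - s) / α)
          ⟨by rw [← neg_div]; gcongr; exact hts.1, (div_le_one h0).2 hts.2⟩
        refine ⟨α * x + s, branch_mem hα hs hx, y, hy, ?_⟩
        calc |α * x + s - r * y - t| = α * |x - r / α * y - (t - s) / α| := by
              rw [← abs_of_pos h0, ← abs_mul, abs_of_pos h0]
              congr 1
              field_simp
              ring
          _ ≤ α * (ρ ^ n * (1 + r / α)) := by gcongr
          _ = ρ ^ n * (α + r) := by field_simp
          _ ≤ ρ ^ n * (ρ * (1 + r)) := by gcongr; exact hρα r hr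
          _ = _ := by ring
      · obtain ⟨s, hs, hts⟩ : ∃ s, (s = 0 ∨ s = 1 - β) ∧ t + r * s ∈ Icc (-(r * β)) 1 := by
          by_cases hta : -(r * β) ≤ t
          · exact ⟨0, Or.inl rfl, by linarith, by linarith [ht.2]⟩
          · exact ⟨1 - β, Or.inr rfl, by linarith [ht.1], by linarith⟩
        obtain ⟨x, hx, y, hy, hxy⟩ := ih (r * β) hmem (t + r * s) hts
        refine ⟨x, hx, β * y + s, branch_mem hβ hs hy, ?_⟩
        calc |x - r * (β * y + s) - t| = |x - r * β * y - (t + r * s)| := by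
              congr 1
              ring
          _ ≤ ρ ^ n * (1 + r * β) := hxy
          _ ≤ ρ ^ n * (ρ * (1 + r)) := by gcongr; exact hρβ r hr
          _ = _ := by ring
  have hl0 : 0 < l := hm.trans_le (hS hl).1
  apply Subset.antisymm
  · rintro _ ⟨x, hx, -, ⟨y, hy, rfl⟩, rfl⟩
    have hx' := middleCantorSet_subset_Icc hα hx
    have hy' := middleCantorSet_subset_Icc hβ hy
    simp only [smul_eq_mul]
    constructor <;> nlinarith [hx'.1, hx'.2, hy'.1, hy'.2]
  · intro t ht
    have hclosed : IsClosed (middleCantorSet α - l • middleCantorSet β) :=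
      IsCompact.isClosed (by
        rw [sub_eq_add_neg]
        exact (isCompact_middleCantorSet hα).add ((isCompact_middleCantorSet hβ).smul l).neg)
    rw [← hclosed.closure_eq, Metric.mem_closure_iff]
    intro ε hε
    obtain ⟨n, hn⟩ := exists_pow_lt_of_lt_one (div_pos hε (by linarith : 0 < 1 + l)) hρ1
    obtain ⟨x, hx, y, hy, hxy⟩ := approx n l hl t ht
    refine ⟨x - l • y, Set.sub_mem_sub hx (Set.smul_mem_smul_set hy), ?_⟩
    rw [dist_comm, Real.dist_eq, smul_eq_mul]
    rw [lt_div_iff₀ (by linarith)] at hn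
    exact hxy.trans_lt hn

/-! ### Quotients of powers of `1 / α` and `1 / β` -/

theorem one_lt_of_pow_eq_one_div {γ : ℝ} {n₀ m₀ : ℕ} (hα : α ∈ Ioo (0 : ℝ) (1 / 2))
    (hβ : β ∈ Ioo (0 : ℝ) (1 / 2)) (hc : Nat.Coprime n₀ m₀) (hp : 1 / α = γ ^ n₀)
    (hq : 1 / β = γ ^ m₀) : 1 < γ := by
  have hp1 : 1 < γ ^ n₀ := by rw [← hp, lt_div_iff₀ hα.1]; linarith [hα.2]
  have hq1 : 1 < γ ^ m₀ := by rw [← hq, lt_div_iff₀ hβ.1]; linarith [hβ.2]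
  have hn : n₀ ≠ 0 := by rintro rfl; simp at hp1
  have habs : 1 < |γ| := by
    by_contra! h
    have := pow_le_one₀ (n := n₀) (abs_nonneg γ) h
    rw [← abs_pow] at this
    exact absurd (le_abs_self _) (by linarith : ¬ γ ^ n₀ ≤ |γ ^ n₀|)
  rcases le_or_gt 0 γ with h | h
  · rwa [abs_of_nonneg h] at habs
  · -- for negative `γ` both exponents would be even
    exfalso
    have ev : ∀ n : ℕ, 1 < γ ^ n → Even n := fun n hn => by
      by_contra hodd
      linarith [(Nat.not_even_iff_odd.1 hodd).pow_neg h]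
    have := Nat.dvd_gcd (ev n₀ hp1).two_dvd (ev m₀ hq1).two_dvd
    rw [hc.gcd_eq_one] at this
    omega

theorem exists_mul_sub_mul_eq {n₀ m₀ : ℕ} (hc : Nat.Coprime n₀ m₀) (hn : 0 < n₀) (hm : 0 < m₀)
    (e : ℤ) : ∃ k j : ℕ, (n₀ : ℤ) * k - m₀ * j = e := by
  have hb : (n₀ : ℤ) * n₀.gcdA m₀ + m₀ * n₀.gcdB m₀ = 1 := by
    rw [← Nat.gcd_eq_gcd_ab, hc.gcd_eq_one]; rfl
  -- a Bézout solution, shifted by a large multiple of `(m₀, n₀)` to make both entries nonnegative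
  set A := e * n₀.gcdA m₀
  set B := e * n₀.gcdB m₀
  have hk : 0 ≤ A + m₀ * (|A| + |B|) := by
    nlinarith [neg_abs_le A, abs_nonneg A, abs_nonneg B, (by exact_mod_cast hm : (1 : ℤ) ≤ m₀)]
  have hj : 0 ≤ -B + n₀ * (|A| + |B|) := by
    nlinarith [le_abs_self B, abs_nonneg A, abs_nonneg B, (by exact_mod_cast hn : (1 : ℤ) ≤ n₀)]
  obtain ⟨k, hk⟩ := Int.eq_ofNat_of_zero_le hk
  obtain ⟨j, hj⟩ := Int.eq_ofNat_of_zero_le hj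
  refine ⟨k, j, ?_⟩
  rw [← hk, ← hj]
  linear_combination e * hb

/-- For `a / b` irrational, the natural combinations `k * a - j * b` are dense in the line. The
shift by a large multiple `N * a` forces the coefficient of `b` to be at most `0`. -/
theorem exists_mul_sub_mul_mem_Ioo {a b c d : ℝ} (ha : 0 < a) (hb : 0 < b) (hab : Irrational (a / b))
    (hcd : c < d) : ∃ k j : ℕ, (k : ℝ) * a - j * b ∈ Ioo c d := by
  have : Fact (0 < b) := ⟨hb⟩
  obtain ⟨N, hN⟩ := exists_nat_gt (d / a)
  rw [div_lt_iff₀ ha] at hN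
  have hd : DenseRange (· • (a : AddCircle b) : ℕ → AddCircle b) :=
    denseRange_zsmul_iff_nsmul.1 (AddCircle.denseRange_zsmul_coe_iff.2 hab)
  have hopen : IsOpen ((QuotientAddGroup.mk : ℝ → AddCircle b) '' Ioo (c - N * a) (d - N * a)) :=
    QuotientAddGroup.isOpenMap_coe _ isOpen_Ioo
  obtain ⟨n, y, hy, hyn⟩ := hd.exists_mem_open hopen
    ((nonempty_Ioo.2 (by linarith : c - N * a < d - N * a)).image _)
  have hyn' : ((n * a - y : ℝ) : AddCircle b) = 0 := by
    have e : ((n * a : ℝ) : AddCircle b) = n • (a : AddCircle b) := by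
      rw [← nsmul_eq_mul]; rfl
    rw [AddCircle.coe_sub, e]
    exact sub_eq_zero.2 hyn.symm
  obtain ⟨z, hz⟩ := (AddCircle.coe_eq_zero_iff b).1 hyn'
  rw [zsmul_eq_mul] at hz
  have hz0 : 0 ≤ z := by
    have : 0 < (z : ℝ) * b := by
      rw [hz]
      nlinarith [hy.2, mul_nonneg n.cast_nonneg ha.le]
    have := pos_of_mul_pos_left this hb.le
    exact_mod_cast this.le
  obtain ⟨j, rfl⟩ := Int.eq_ofNat_of_zero_le hz0
  refine ⟨N + n, j, ?_⟩
  push_cast at hz ⊢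
  constructor <;> nlinarith [hy.1, hy.2]

/-! ### The three cases -/

theorem sub_ne_Icc_of_irrational (hα : α ∈ Ioo (0 : ℝ) (1 / 2)) (hβ : β ∈ Ioo (0 : ℝ) (1 / 2))
    (hlt : α / (1 - 2 * β) < (1 - 2 * α) / β) (hirr : Irrational (Real.log α / Real.log β)) (l : ℝ) :
    middleCantorSet α - l • middleCantorSet β ≠ Icc (-l) 1 := by
  intro h
  have hl := pos_of_sub_eq_Icc h hα hβ
  have h0 := hα.1
  have h0' := hβ.1
  have hA : 0 < α / (1 - 2 * β) := div_pos h0 (by linarith [hβ.2])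
  have la : 0 < -Real.log α := neg_pos.2 (Real.log_neg h0 (by linarith [hα.2]))
  have lb : 0 < -Real.log β := neg_pos.2 (Real.log_neg h0' (by linarith [hβ.2]))
  obtain ⟨k, j, hkj⟩ := exists_mul_sub_mul_mem_Ioo la lb (by rwa [neg_div_neg_eq])
    (sub_lt_sub_right (Real.log_lt_log hA hlt) (Real.log l))
  refine ratio_notMem_Ioo_of_sub_eq_Icc h hα hβ k j ?_
  have hpos : 0 < l * β ^ j / α ^ k := by positivity
  have e : Real.log (l * β ^ j / α ^ k) =
      Real.log l + (k * -Real.log α - j * -Real.log β) := by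
    rw [Real.log_div (by positivity) (by positivity), Real.log_mul hl.ne' (by positivity),
      Real.log_pow, Real.log_pow]
    ring
  constructor
  · rw [← Real.log_lt_log_iff hA hpos, e]
    linarith [hkj.1]
  · rw [← Real.log_lt_log_iff hpos (hA.trans hlt), e]
    linarith [hkj.2]

/-- In the commensurable case the ratios `l * β ^ j / α ^ k` are all the `l * γ ^ e` with `e` an
integer, so the power that falls last below the forbidden interval lies within a factor `γ` of it. -/
theorem exists_zpow_mul_eq_of_sub_eq_Icc {γ : ℝ} {n₀ m₀ : ℕ}
    (h : middleCantorSet α - l • middleCantorSet β = Icc (-l) 1)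
    (hα : α ∈ Ioo (0 : ℝ) (1 / 2)) (hβ : β ∈ Ioo (0 : ℝ) (1 / 2))
    (hc : Nat.Coprime n₀ m₀) (hp : 1 / α = γ ^ n₀) (hq : 1 / β = γ ^ m₀) :
    ∃ n : ℤ, ∃ z ∈ Icc ((1 - 2 * α) / (γ * β)) (α / (1 - 2 * β)), γ ^ n * z = l := by
  have hγ := one_lt_of_pow_eq_one_div hα hβ hc hp hq
  have hγ0 : 0 < γ := by linarith
  have hl := pos_of_sub_eq_Icc h hα hβ
  have h0 := hα.1
  have h0' := hβ.1
  have hA : 0 < α / (1 - 2 * β) := div_pos h0 (by linarith [hβ.2])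
  have hn : 0 < n₀ := Nat.pos_of_ne_zero fun h => by
    rw [h, pow_zero, div_eq_one_iff_eq h0.ne'] at hp; linarith [hα.2]
  have hm : 0 < m₀ := Nat.pos_of_ne_zero fun h => by
    rw [h, pow_zero, div_eq_one_iff_eq h0'.ne'] at hq; linarith [hβ.2]
  have avoid : ∀ e : ℤ, l * γ ^ e ∉ Ioo (α / (1 - 2 * β)) ((1 - 2 * α) / β) := by
    intro e
    obtain ⟨k, j, rfl⟩ := exists_mul_sub_mul_eq hc hn hm e
    have := ratio_notMem_Ioo_of_sub_eq_Icc h hα hβ k j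
    have e1 : l * β ^ j / α ^ k = l * γ ^ ((n₀ : ℤ) * k - m₀ * j) := by
      rw [zpow_sub₀ hγ0.ne', zpow_mul, zpow_mul, zpow_natCast, zpow_natCast, zpow_natCast,
        zpow_natCast, ← hp, ← hq, one_div_pow, one_div_pow]
      field_simp
    rwa [e1] at this
  obtain ⟨n, hn1, hn2⟩ := exists_mem_Ioc_zpow (div_pos hl hA) hγ
  rw [lt_div_iff₀ hA] at hn1
  rw [div_le_iff₀ hA] at hn2
  have hz : 0 < γ ^ n := zpow_pos hγ0 n
  rw [zpow_add_one₀ hγ0.ne'] at hn2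
  refine ⟨n + 1, l * γ ^ (-(n + 1)), ⟨?_, ?_⟩, ?_⟩
  · have := avoid (-n)
    rw [mem_Ioo, not_and_or, not_lt, not_lt, zpow_neg, ← div_eq_mul_inv, div_le_iff₀ hz,
      div_le_div_iff₀ h0' hz] at this
    rw [zpow_neg, zpow_add_one₀ hγ0.ne', ← div_eq_mul_inv, div_le_div_iff₀ (by positivity)
      (by positivity)]
    rcases this with h | h
    · linarith
    · nlinarith
  · rw [zpow_neg, zpow_add_one₀ hγ0.ne', ← div_eq_mul_inv, div_le_iff₀ (by positivity)]
    linarith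
  · rw [zpow_neg]
    have : γ ^ (n + 1) ≠ 0 := (zpow_pos hγ0 _).ne'
    field_simp

/-- The ratios in the union of intervals are closed under splitting: `C_α` is split when `n ≤ 0`, which
adds `n₀` to `n`, and `C_β` when `n ≥ 1`, which subtracts `m₀`. -/
theorem sub_eq_Icc_of_zpow_mul {γ z : ℝ} {n₀ m₀ : ℕ} {n : ℤ}
    (hα : α ∈ Ioo (0 : ℝ) (1 / 2)) (hβ : β ∈ Ioo (0 : ℝ) (1 / 2)) (hγ : 1 < γ)
    (hp : 1 / α = γ ^ n₀) (hq : 1 / β = γ ^ m₀) (hn : n ∈ Icc (-(m₀ : ℤ) + 1) (n₀ : ℤ))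
    (hz : z ∈ Icc ((1 - 2 * α) / (γ * β)) (α / (1 - 2 * β))) :
    middleCantorSet α - (γ ^ n * z) • middleCantorSet β = Icc (-(γ ^ n * z)) 1 := by
  have h0 := hα.1
  have h0' := hβ.1
  have h2 : 0 < 1 - 2 * α := by linarith [hα.2]
  have h2' : 0 < 1 - 2 * β := by linarith [hβ.2]
  have hγ0 : 0 < γ := by linarith
  have eα : α = γ ^ (-(n₀ : ℤ)) := by rw [zpow_neg, zpow_natCast, ← hp]; field_simp
  have eβ : β = γ ^ (-(m₀ : ℤ)) := by rw [zpow_neg, zpow_natCast, ← hq]; field_simp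
  have hzlo : ∀ w ∈ Icc ((1 - 2 * α) / (γ * β)) (α / (1 - 2 * β)), 1 - 2 * α ≤ w * (γ * β) :=
    fun w hw => (div_le_iff₀ (by positivity)).1 hw.1
  have hzhi : ∀ w ∈ Icc ((1 - 2 * α) / (γ * β)) (α / (1 - 2 * β)), w * (1 - 2 * β) ≤ α :=
    fun w hw => (le_div_iff₀ h2').1 hw.2
  have hlo : ∀ e : ℤ, -(m₀ : ℤ) + 1 ≤ e → γ * β ≤ γ ^ e := fun e he => by
    calc γ * β = γ ^ (-(m₀ : ℤ) + 1) := by rw [zpow_add_one₀ hγ0.ne', ← eβ, mul_comm]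
      _ ≤ γ ^ e := zpow_le_zpow_right₀ hγ.le he
  have hhi : ∀ e : ℤ, e ≤ n₀ → γ ^ e * α ≤ 1 := fun e he => by
    calc γ ^ e * α ≤ γ ^ (n₀ : ℤ) * α := by gcongr; exact hγ.le
      _ = 1 := by rw [zpow_natCast, ← hp]; field_simp
  have hpos : ∀ w ∈ Icc ((1 - 2 * α) / (γ * β)) (α / (1 - 2 * β)), 0 < w := fun w hw =>
    lt_of_lt_of_le (by positivity) hw.1
  refine sub_eq_Icc_of_splitting hα hβ (m := 1 - 2 * α) (M := 1 / (1 - 2 * β))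
    (S := {r | ∃ e ∈ Icc (-(m₀ : ℤ) + 1) (n₀ : ℤ),
      ∃ w ∈ Icc ((1 - 2 * α) / (γ * β)) (α / (1 - 2 * β)), r = γ ^ e * w}) h2 ?_ ?_
    ⟨n, hn, z, hz, rfl⟩
  · rintro _ ⟨e, he, w, hw, rfl⟩
    constructor
    · nlinarith [hzlo w hw, mul_le_mul_of_nonneg_right (hlo e he.1) (hpos w hw).le]
    · rw [le_div_iff₀ h2']
      nlinarith [mul_le_mul_of_nonneg_left (hzhi w hw) (zpow_pos hγ0 e).le, hhi e he.2]
  · rintro _ ⟨e, he, w, hw, rfl⟩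
    rcases le_or_gt e 0 with h | h
    · refine Or.inl ⟨?_, e + n₀, ⟨by linarith [he.1], by linarith⟩, w, hw, ?_⟩
      · nlinarith [hzlo w hw, mul_le_mul_of_nonneg_right (hlo e he.1) (hpos w hw).le]
      · rw [zpow_add₀ hγ0.ne', zpow_natCast, ← hp]
        ring
    · refine Or.inr ⟨?_, e - m₀, ⟨by linarith, by linarith [he.2]⟩, w, hw, ?_⟩
      · nlinarith [mul_le_mul_of_nonneg_left (hzhi w hw) (zpow_pos hγ0 e).le, hhi e he.2]
      · rw [sub_eq_add_neg, zpow_add₀ hγ0.ne', ← eβ]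
        ring

theorem theorem7 (α β : ℝ) (hα : α ∈ Set.Ioo (0 : ℝ) (1 / 2)) (hβ : β ∈ Set.Ioo (0 : ℝ) (1 / 2))
    (hτ : thickness (middleCantorSet α) * thickness (middleCantorSet β) < 1) :
    (∀ (γ : ℝ) (n₀ m₀ : ℕ), Nat.Coprime n₀ m₀ → 1 / α = γ ^ n₀ → 1 / β = γ ^ m₀ →
      (ENNReal.ofReal (1 / γ) ≤ thickness (middleCantorSet α) * thickness (middleCantorSet β) →
        ∀ l : ℝ,
          l ∈ ⋃ n ∈ Set.Icc (-(m₀ : ℤ) + 1) (n₀ : ℤ),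
              γ ^ n • Set.Icc ((1 - 2 * α) / (γ * β)) (α / (1 - 2 * β)) ↔
            middleCantorSet α - l • middleCantorSet β = Set.Icc (-l) 1) ∧
      (thickness (middleCantorSet α) * thickness (middleCantorSet β) < ENNReal.ofReal (1 / γ) →
        ∀ l : ℝ, middleCantorSet α - l • middleCantorSet β ≠ Set.Icc (-l) 1)) ∧
    (Irrational (Real.log α / Real.log β) →
      ∀ l : ℝ, middleCantorSet α - l • middleCantorSet β ≠ Set.Icc (-l) 1) := by
  have h0 := hα.1
  have h0' := hβ.1
  have h2 : 0 < 1 - 2 * α := by linarith [hα.2]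
  have h2' : 0 < 1 - 2 * β := by linarith [hβ.2]
  have hlt : α * β < (1 - 2 * α) * (1 - 2 * β) := by
    rw [thickness_middleCantorSet hα, thickness_middleCantorSet hβ,
      ← ENNReal.ofReal_mul (by positivity), ENNReal.ofReal_lt_one, div_mul_div_comm,
      div_lt_one (by positivity)] at hτ
    exact hτ
  refine ⟨fun γ n₀ m₀ hc hp hq => ?_, sub_ne_Icc_of_irrational hα hβ ?_⟩
  · have hγ := one_lt_of_pow_eq_one_div hα hβ hc hp hq
    have hγ0 : 0 < γ := by linarith
    refine ⟨fun _ l => ⟨fun hl => ?_, fun h => ?_⟩, fun hlarge l h => ?_⟩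
    · simp only [mem_iUnion, Set.mem_smul_set, smul_eq_mul] at hl
      obtain ⟨n, hn, z, hz, rfl⟩ := hl
      exact sub_eq_Icc_of_zpow_mul hα hβ hγ hp hq hn hz
    · obtain ⟨n, z, hz, hzl⟩ := exists_zpow_mul_eq_of_sub_eq_Icc h hα hβ hc hp hq
      obtain ⟨hlo, hhi⟩ := ratio_bounds_of_sub_eq_Icc h hα hβ
      simp only [mem_iUnion, Set.mem_smul_set, smul_eq_mul]
      refine ⟨n, ?_, z, hz, hzl⟩
      have hzlo : 1 - 2 * α ≤ z * (γ * β) := (div_le_iff₀ (by positivity)).1 hz.1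
      have hzhi : z * (1 - 2 * β) ≤ α := (le_div_iff₀ h2').1 hz.2
      have hz0 : 0 < z := lt_of_lt_of_le (by positivity) hz.1
      subst hzl
      constructor
      · -- otherwise `γ ^ n ≤ β`, and the ratio is too small
        by_contra! hcon
        have hle : γ ^ n ≤ β := by
          calc γ ^ n ≤ γ ^ (-(m₀ : ℤ)) := zpow_le_zpow_right₀ hγ.le (by omega)
            _ = β := by rw [zpow_neg, zpow_natCast, ← hq]; field_simp
        have : (1 - 2 * α) * (1 - 2 * β) ≤ β * α := by
          calc (1 - 2 * α) * (1 - 2 * β) ≤ γ ^ n * z * (1 - 2 * β) := by gcongr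
            _ = γ ^ n * (z * (1 - 2 * β)) := by ring
            _ ≤ β * α := by gcongr
        linarith
      · -- otherwise `γ ^ n ≥ γ / α`, and the ratio is too large
        by_contra! hcon
        have hle : γ ≤ γ ^ n * α := by
          calc γ = γ ^ (n₀ : ℤ) * γ * α := by rw [zpow_natCast, ← hp]; field_simp
            _ = γ ^ ((n₀ : ℤ) + 1) * α := by rw [zpow_add_one₀ hγ0.ne']
            _ ≤ γ ^ n * α := by
              gcongr
              · exact hγ.le
              · omega
        have : γ * ((1 - 2 * α) * (1 - 2 * β)) ≤ γ * (α * β) := by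
          calc γ * ((1 - 2 * α) * (1 - 2 * β))
              ≤ (γ ^ n * α) * ((z * (γ * β)) * (1 - 2 * β)) := by gcongr
            _ = (γ ^ n * z * (1 - 2 * β)) * (γ * (α * β)) := by ring
            _ ≤ 1 * (γ * (α * β)) := by gcongr
            _ = _ := one_mul _
        linarith [le_of_mul_le_mul_left this hγ0]
    · obtain ⟨n, z, hz, -⟩ := exists_zpow_mul_eq_of_sub_eq_Icc h hα hβ hc hp hq
      have := hz.1.trans hz.2
      rw [div_le_div_iff₀ (by positivity) h2'] at this
      rw [thickness_middleCantorSet hα, thickness_middleCantorSet hβ,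
        ← ENNReal.ofReal_mul (by positivity),
        ENNReal.ofReal_lt_ofReal_iff (by positivity), div_mul_div_comm,
        div_lt_div_iff₀ (by positivity) hγ0] at hlarge
      linarith
  · rw [div_lt_div_iff₀ h2' h0']
    exact hlt
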